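/- Let $T,\alpha,\beta>0$. Let $M(0,T)$ be the space of finite signed Borel measures on $(0,T)$ with $\|\mu\|_M=|\mu|((0,T))$, and let $BV(0,T)$ be the space of functions $u\in L^1(0,T)$ whose distributional derivative $Du$ belongs to $M(0,T)$. For $u\in L^1(0,T)$ put $$\operatorname{TGV}(u)=\sup\Big\{\int_0^T u\,v''\,dx \;\Big|\; v\in C_c^\infty(0,T),\ \|v\|_\infty\le\beta,\ \|v'\|_\infty\le\alpha\Big\},$$ and for $\bar u\in BV(0,T)$ define $$\partial_2\operatorname{TGV}(\bar u)=\big\{\varphi\in L^2(0,T)\;\big|\;(\varphi,u-\bar u)_{L^2}+\operatorname{TGV}(\bar u)\le\operatorname{TGV}(u)\ \text{ for all } u\in BV(0,T)\big\}.$$ Let $\bar u\in BV(0,T)$, and let $\bar w\in BV(0,T)$ be such that $$\operatorname{TGV}(\bar u)=\alpha\|D\bar u-\bar w\|_M+\beta\|D\bar w\|_M,$$ where $\bar w$ is identified with the measure $\bar w\,dx$. For $\bar\varphi\in L^2(0,T)$ define $$\bar p(x)=-\int_0^x\bar\varphi(t)\,dt,\qquad \bar P(x)=-\int_0^x\bar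 p(t)\,dt .$$ Then $\bar\varphi\in\partial_2\operatorname{TGV}(\bar u)$ if and only if both of the following hold: 1. $\bar p\in H^1_0(0,T)$, $\bar P\in H^2(0,T)\cap H^1_0(0,T)$, $|\bar p(x)|\le\alpha$ and $|\bar P(x)|\le\beta$ for all $x\in(0,T)$; 2. $\operatorname{supp}(D\bar u-\bar w)_\pm\subset\{x\in(0,T)\mid \bar p(x)=\pm\alpha\}$ and $\operatorname{supp}(D\bar w)_\pm\subset\{x\in(0,T)\mid \bar P(x)=\pm\beta\}$. Here $\mu_+$ and $\mu_-$ are the positive and negative parts in the Jordan decomposition $\mu=\mu_+-\mu_-$, supports are taken relative to $(0,T)$, and $H^1_0(0,T)$ is the closure of $C_c^\infty(0,T)$ in $H^1(0,T)$. -/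

import Mathlib

open MeasureTheory Set TopologicalSpace
open scoped ENNReal Distributions

noncomputable section

namespace TGV1D

/-- The open interval `(0, T)` as an open subset of the real line. -/
def interval (T : ℝ) : Opens ℝ := ⟨Ioo 0 T, isOpen_Ioo⟩

/-- `M(0,T)`: finite signed Borel measures on the interval `(0,T)`. Topological notions such as
supports are relative to `(0,T)`. -/
abbrev M (T : ℝ) : Type := SignedMeasure (Ioo (0 : ℝ) T)

/-- The norm `‖μ‖_M = |μ|((0,T))`. -/
def mNorm {T : ℝ} (μ : M T) : ℝ := μ.totalVariation.real univ

/-- Lebesgue measure on `(0,T)`, as a measure on the real line. Functions on `(0,T)` are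
represented by functions on `ℝ` whose values outside `(0,T)` play no role. -/
abbrev leb (T : ℝ) : Measure ℝ := volume.restrict (Ioo 0 T)

/-- The function `w`, integrable on `(0,T)`, regarded as the measure `w dx` on `(0,T)`. -/
def toM (T : ℝ) (w : ℝ → ℝ) : M T :=
  ((volume : Measure ℝ).comap ((↑) : Ioo (0 : ℝ) T → ℝ)).withDensityᵥ (fun x => w x)

/-- The measure `μ` on `(0,T)` is the distributional derivative of `u`:
`∫ u v' dx = - ∫ v dμ` for all `v ∈ C_c^∞(0,T)`. -/
def IsMeasDeriv (T : ℝ) (u : ℝ → ℝ) (μ : M T) : Prop :=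
  ∀ v : 𝓓(interval T, ℝ), ∫ x, u x * deriv v x ∂(leb T) = - ∫ᵛ x, v (x : ℝ) ∂<•μ

/-- `u ∈ BV(0,T)`: `u` is in `L¹(0,T)` and its distributional derivative is a finite signed
measure. -/
def MemBV (T : ℝ) (u : ℝ → ℝ) : Prop :=
  Integrable u (leb T) ∧ ∃ μ : M T, IsMeasDeriv T u μ

open Classical in
/-- The distributional derivative `Du ∈ M(0,T)` of `u ∈ BV(0,T)` (and `0` for other `u`). -/
def D (T : ℝ) (u : ℝ → ℝ) : M T :=
  if h : ∃ μ : M T, IsMeasDeriv T u μ then h.choose else 0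

theorem MemBV.isMeasDeriv_D {T : ℝ} {u : ℝ → ℝ} (hu : MemBV T u) : IsMeasDeriv T u (D T u) := by
  rw [D, dif_pos hu.2]
  exact hu.2.choose_spec

/-- The second order total generalized variation
`TGV(u) = sup {∫ u v'' dx | v ∈ C_c^∞(0,T), ‖v‖_C ≤ β, ‖v'‖_C ≤ α}`, where `α` weighs the first
order and `β` the second order part. -/
def TGV (T α β : ℝ) (u : ℝ → ℝ) : EReal :=
  ⨆ v : {v : 𝓓(interval T, ℝ) //
      (∀ x ∈ Ioo 0 T, |v x| ≤ β) ∧ (∀ x ∈ Ioo 0 T, |deriv v x| ≤ α)},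
    ((∫ x, u x * deriv (deriv v.1) x ∂(leb T) : ℝ) : EReal)

/-- The `L²`-subdifferential of `TGV` at `ubar`: all `φ ∈ L²(0,T)` with
`(φ, u - ubar)_{L²} + TGV(ubar) ≤ TGV(u)` for all `u ∈ BV(0,T)`. -/
def subdiff (T α β : ℝ) (ubar : ℝ → ℝ) : Set (ℝ → ℝ) :=
  {φ | MemLp φ 2 (leb T) ∧ ∀ u : ℝ → ℝ, MemBV T u →
    ((∫ x, φ x * (u x - ubar x) ∂(leb T) : ℝ) : EReal) + TGV T α β ubar ≤ TGV T α β u}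

/-- `g` is the weak derivative of `f` on `(0,T)`. -/
def IsWeakDeriv (T : ℝ) (f g : ℝ → ℝ) : Prop :=
  ∀ v : 𝓓(interval T, ℝ), ∫ x, f x * deriv v x ∂(leb T) = - ∫ x, g x * v x ∂(leb T)

/-- `f ∈ H¹₀(0,T)`, the closure of `C_c^∞(0,T)` in `H¹(0,T)`. -/
def MemH10 (T : ℝ) (f : ℝ → ℝ) : Prop :=
  ∃ g : ℝ → ℝ, MemLp f 2 (leb T) ∧ MemLp g 2 (leb T) ∧ IsWeakDeriv T f g ∧
    ∀ ε : ℝ≥0∞, 0 < ε → ∃ v : 𝓓(interval T, ℝ),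
      eLpNorm (fun x => f x - v x) 2 (leb T) +
        eLpNorm (fun x => g x - deriv v x) 2 (leb T) < ε

/-- `f ∈ H²(0,T)`: `f` and its first and second weak derivatives are in `L²(0,T)`. -/
def MemH2 (T : ℝ) (f : ℝ → ℝ) : Prop :=
  ∃ g h : ℝ → ℝ, MemLp f 2 (leb T) ∧ MemLp g 2 (leb T) ∧ MemLp h 2 (leb T) ∧
    IsWeakDeriv T f g ∧ IsWeakDeriv T g h

/-- The function `x ↦ - ∫₀ˣ f(t) dt`. -/
def negPrimitive (f : ℝ → ℝ) (x : ℝ) : ℝ := - ∫ t in (0 : ℝ)..x, f t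

/-- The support (relative to `(0,T)`) of the positive part of the Jordan decomposition. -/
def suppPos {T : ℝ} (μ : M T) : Set (Ioo (0 : ℝ) T) := μ.toJordanDecomposition.posPart.support

/-- The support (relative to `(0,T)`) of the negative part of the Jordan decomposition. -/
def suppNeg {T : ℝ} (μ : M T) : Set (Ioo (0 : ℝ) T) := μ.toJordanDecomposition.negPart.support

end TGV1D

end

open Filter Topology
open scoped ContDiff

noncomputable section

namespace TGV1D

variable {T α β : ℝ}

/-! By construction P' = -p and P'' = φ. If p and P vanish at both ends, two integrations by parts
give ∫ φ u = ∫ p d(Du - w) + ∫ P dDw for all u, w in BV (`integral_mul_eq_integral_add_integral`).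
When |p| ≤ α and |P| ≤ β, the right side is at most α‖Du - w‖ + β‖Dw‖, with equality exactly when
the Jordan parts are supported where p = ±α and P = ±β (`integral_eq_mul_mNorm_iff`). At `ubar`,
`wbar` this bound is TGV(ubar) by hypothesis, so given condition 1, condition 2 says ∫ φ ubar =
TGV(ubar).

Since TGV is a supremum of linear functionals and TGV(ubar) is finite, φ is a subgradient iff this
equality holds and ∫ φ u ≤ TGV(u) on BV. It remains to match the inequality with condition 1.
Necessity (`conditions_of_mem_subdiff`): constants and linear functions force φ and p to have mean
zero, which are the boundary conditions; jumps give |p| ≤ α and kinks give |P| ≤ β. Sufficiency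
(`integral_mul_le_TGV`): φ is an L² limit of second derivatives of test functions, which become
admissible after a slight rescaling; the limit passes under the integral because BV functions are
essentially bounded. The representation of TGV as a minimum over w is used only through the
hypothesis at `ubar`. -/

/-! ### Integrals and test functions on (0,T). -/

theorem integral_leb (hT : 0 < T) (f : ℝ → ℝ) :
    ∫ x, f x ∂(leb T) = ∫ x in (0 : ℝ)..T, f x := by
  rw [intervalIntegral.integral_of_le hT.le, integral_Ioc_eq_integral_Ioo]

theorem intervalIntegrable_of_integrable_leb (hT : 0 < T) {f : ℝ → ℝ}
    (hf : Integrable f (leb T)) : IntervalIntegrable f volume 0 T := by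
  rw [intervalIntegrable_iff_integrableOn_Ioo_of_le hT.le]
  exact hf

theorem intervalIntegrable_of_mem_Icc (hT : 0 < T) {f : ℝ → ℝ} (hf : Integrable f (leb T))
    {a b : ℝ} (ha : a ∈ Icc 0 T) (hb : b ∈ Icc 0 T) : IntervalIntegrable f volume a b := by
  refine (intervalIntegrable_of_integrable_leb hT hf).mono_set ?_
  rw [uIcc_of_le hT.le]
  exact uIcc_subset_Icc ha hb

theorem integrable_leb_of_memLp {f : ℝ → ℝ} (hf : MemLp f 2 (leb T)) : Integrable f (leb T) :=
  hf.integrable (by norm_num)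

theorem integrable_leb_of_continuousOn {f : ℝ → ℝ} (hf : ContinuousOn f (Icc 0 T)) :
    Integrable f (leb T) :=
  (hf.integrableOn_Icc (μ := volume)).mono_set Ioo_subset_Icc_self

theorem memLp_leb_of_continuousOn {f : ℝ → ℝ} (hf : ContinuousOn f (Icc 0 T)) :
    MemLp f 2 (leb T) := by
  obtain ⟨C, hC⟩ := isCompact_Icc.exists_bound_of_continuousOn hf
  refine MemLp.of_bound (integrable_leb_of_continuousOn hf).aestronglyMeasurable C ?_
  filter_upwards [ae_restrict_mem measurableSet_Ioo] with x hx
  exact hC x (Ioo_subset_Icc_self hx)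

theorem tsupport_deriv_subset_tsupport (f : ℝ → ℝ) : tsupport (deriv f) ⊆ tsupport f :=
  closure_minimal (support_deriv_subset (f := f)) (isClosed_tsupport f)

/-- The derivative of a test function, as a test function. -/
def testDeriv (v : 𝓓(interval T, ℝ)) : 𝓓(interval T, ℝ) where
  toFun := deriv v
  contDiff' := (contDiff_infty_iff_deriv.1 v.contDiff).2
  hasCompactSupport' := v.hasCompactSupport.deriv
  tsupport_subset' := (tsupport_deriv_subset_tsupport v).trans v.tsupport_subset

@[simp]
theorem coe_testDeriv (v : 𝓓(interval T, ℝ)) : ⇑(testDeriv v) = deriv v := rfl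

theorem test_differentiable (v : 𝓓(interval T, ℝ)) : Differentiable ℝ v :=
  v.contDiff.differentiable (by simp)

theorem test_hasDerivAt (v : 𝓓(interval T, ℝ)) (x : ℝ) : HasDerivAt v (deriv v x) x :=
  (test_differentiable v x).hasDerivAt

theorem test_continuous_deriv (v : 𝓓(interval T, ℝ)) : Continuous (deriv v) :=
  (testDeriv v).continuous

theorem test_eq_zero (v : 𝓓(interval T, ℝ)) {x : ℝ} (hx : x ∉ Ioo 0 T) : v x = 0 :=
  image_eq_zero_of_notMem_tsupport fun h => hx (v.tsupport_subset h)

theorem test_zero (v : 𝓓(interval T, ℝ)) : v 0 = 0 := test_eq_zero v (by simp)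

theorem test_right (v : 𝓓(interval T, ℝ)) : v T = 0 := test_eq_zero v (by simp)

theorem test_integrable (v : 𝓓(interval T, ℝ)) : Integrable v (leb T) :=
  integrable_leb_of_continuousOn v.continuous.continuousOn

theorem test_memLp (v : 𝓓(interval T, ℝ)) : MemLp v 2 (leb T) :=
  memLp_leb_of_continuousOn v.continuous.continuousOn

theorem test_integral_deriv (v : 𝓓(interval T, ℝ)) (a b : ℝ) :
    ∫ x in a..b, deriv v x = v b - v a :=
  intervalIntegral.integral_deriv_eq_sub (fun x _ => test_differentiable v x)
    ((test_continuous_deriv v).intervalIntegrable _ _)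

theorem test_integral_deriv_leb (hT : 0 < T) (v : 𝓓(interval T, ℝ)) :
    ∫ x, deriv v x ∂(leb T) = 0 := by
  rw [integral_leb hT, test_integral_deriv, test_zero, test_right, sub_zero]

/-- A test function with vanishing integral has a primitive which is a test function. -/
theorem exists_test_deriv_eq (hT : 0 < T) (v : 𝓓(interval T, ℝ))
    (hv : ∫ x, v x ∂(leb T) = 0) : ∃ w : 𝓓(interval T, ℝ), deriv w = v := by
  have hd : ∀ x, HasDerivAt (fun x => ∫ t in (0 : ℝ)..x, v t) (v x) x := fun x =>
    intervalIntegral.integral_hasDerivAt_right (v.continuous.intervalIntegrable _ _)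
      v.continuous.aestronglyMeasurable.stronglyMeasurableAtFilter v.continuous.continuousAt
  have hderiv : deriv (fun x => ∫ t in (0 : ℝ)..x, v t) = v := funext fun x => (hd x).deriv
  -- The primitive vanishes left of a because v does, and right of b because the total integral is
  -- zero. If the support is empty, any interior point serves.
  obtain ⟨a, b, ha, hb, hab⟩ : ∃ a b : ℝ, 0 < a ∧ b < T ∧ tsupport v ⊆ Icc a b := by
    rcases (tsupport v).eq_empty_or_nonempty with h | h
    · exact ⟨T / 2, T / 2, by linarith, by linarith, by simp [h]⟩
    · obtain ⟨a, ha⟩ := v.hasCompactSupport.isCompact.exists_isLeast h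
      obtain ⟨b, hb⟩ := v.hasCompactSupport.isCompact.exists_isGreatest h
      exact ⟨a, b, (v.tsupport_subset ha.1).1, (v.tsupport_subset hb.1).2,
        fun x hx => ⟨ha.2 hx, hb.2 hx⟩⟩
  have hzero : ∀ x, x ∉ Icc a b → v x = 0 := fun x hx =>
    image_eq_zero_of_notMem_tsupport fun h => hx (hab h)
  have hsupp : tsupport (fun x => ∫ t in (0 : ℝ)..x, v t) ⊆ Icc a b := by
    refine closure_minimal (fun x hx => ?_) isClosed_Icc
    by_contra hx'
    apply hx
    rcases not_and_or.1 hx' with h | h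
    · refine intervalIntegral.integral_zero_ae (Eventually.of_forall fun t ht => hzero t ?_)
      rw [mem_uIoc] at ht
      rintro ⟨h1, h2⟩
      rcases ht with ht | ht <;> linarith [ht.2, not_le.1 h]
    · have hT0 : ∫ t in (0 : ℝ)..T, v t = 0 := by rw [← integral_leb hT]; exact hv
      have : ∫ t in T..x, v t = 0 := by
        refine intervalIntegral.integral_zero_ae (Eventually.of_forall fun t ht => hzero t ?_)
        rw [mem_uIoc] at ht
        rintro ⟨h1, h2⟩
        rcases ht with ht | ht <;> linarith [ht.1, not_le.1 h]
      show ∫ t in (0 : ℝ)..x, v t = 0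
      rw [← intervalIntegral.integral_add_adjacent_intervals
        (v.continuous.intervalIntegrable 0 T) (v.continuous.intervalIntegrable T x), hT0, this,
        add_zero]
  refine ⟨⟨fun x => ∫ t in (0 : ℝ)..x, v t, ?_, ?_, ?_⟩, hderiv⟩
  · exact contDiff_infty_iff_deriv.2 ⟨fun x => (hd x).differentiableAt, by rw [hderiv]; exact v.contDiff⟩
  · exact isCompact_Icc.of_isClosed_subset (isClosed_tsupport _) hsupp
  · exact hsupp.trans fun x hx => ⟨ha.trans_le hx.1, hx.2.trans_lt hb⟩

/-- A test function on a nonempty interval with integral one. -/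
theorem exists_test_integral_eq_one (hT : 0 < T) :
    ∃ η : 𝓓(interval T, ℝ), ∫ x, η x ∂(leb T) = 1 := by
  let f : ContDiffBump (T / 2) := ⟨T / 8, T / 4, by positivity, by linarith⟩
  have hts : tsupport f ⊆ Ioo 0 T := by
    rw [f.tsupport_eq, Real.closedBall_eq_Icc]
    intro x hx
    exact ⟨by linarith [hx.1, show f.rOut = T / 4 from rfl],
      by linarith [hx.2, show f.rOut = T / 4 from rfl]⟩
  have hpos : 0 < ∫ x, f x ∂(leb T) := by
    rw [setIntegral_eq_integral_of_forall_compl_eq_zero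
      fun x hx => image_eq_zero_of_notMem_tsupport fun h => hx (hts h)]
    exact f.integral_pos
  let η : 𝓓(interval T, ℝ) := ⟨f, f.contDiff, f.hasCompactSupport, hts⟩
  refine ⟨(∫ x, f x ∂(leb T))⁻¹ • η, ?_⟩
  have : ∀ x, ((∫ x, f x ∂(leb T))⁻¹ • η) x = (∫ x, f x ∂(leb T))⁻¹ * f x := fun x => rfl
  simp_rw [this]
  rw [integral_const_mul, inv_mul_cancel₀ hpos.ne']

/-! ### Primitives and weak derivatives. -/

/-- Primitives of integrable functions are continuous on `[0,T]`. -/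
theorem continuousOn_primitive (hT : 0 < T) {g : ℝ → ℝ} (hg : Integrable g (leb T)) :
    ContinuousOn (fun x => ∫ t in (0 : ℝ)..x, g t) (Icc 0 T) := by
  have := intervalIntegral.continuousOn_primitive_interval (μ := volume) (f := g) (a := 0) (b := T)
    (by
      rw [uIcc_of_le hT.le, integrableOn_Icc_iff_integrableOn_Ioo]
      exact hg)
  rwa [uIcc_of_le hT.le] at this

/-- A primitive of an integrable function has this function as its weak derivative. -/
theorem isWeakDeriv_primitive (hT : 0 < T) {g : ℝ → ℝ} (hg : Integrable g (leb T)) :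
    IsWeakDeriv T (fun x => ∫ t in (0 : ℝ)..x, g t) g := by
  intro v
  have hgi := intervalIntegrable_of_integrable_leb hT hg
  -- A primitive of an L¹ function is only absolutely continuous, so integration by parts is used in
  -- that class, with the derivative identified almost everywhere.
  have hac := hgi.absolutelyContinuousOnInterval_intervalIntegral (c := 0) (by simp)
  have hv : AbsolutelyContinuousOnInterval v 0 T :=
    (v.contDiff.of_le (by exact_mod_cast le_top)).contDiffOn.absolutelyContinuousOnInterval
  rw [integral_leb hT, integral_leb hT, hac.integral_mul_deriv_eq_deriv_mul hv, test_right,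
    test_zero]
  simp only [mul_zero, sub_zero, zero_sub, neg_inj]
  refine intervalIntegral.integral_congr_ae ?_
  filter_upwards [hgi.ae_hasDerivAt_integral] with x hx hx'
  rw [(hx (uIoc_subset_uIcc hx') 0 (by simp)).deriv]

theorem IsWeakDeriv.neg {f g : ℝ → ℝ} (h : IsWeakDeriv T f g) :
    IsWeakDeriv T (fun x => -f x) (fun x => -g x) := by
  intro v
  simp only [neg_mul, integral_neg, h v]

/-- Functions orthogonal to all test functions vanish. -/
theorem ae_eq_zero_of_integral_mul_test {f : ℝ → ℝ} (hf : Integrable f (leb T))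
    (h : ∀ v : 𝓓(interval T, ℝ), ∫ x, f x * v x ∂(leb T) = 0) : f =ᵐ[leb T] 0 := by
  rw [EventuallyEq, ae_restrict_iff' measurableSet_Ioo]
  refine isOpen_Ioo.ae_eq_zero_of_integral_contDiff_smul_eq_zero
    (IntegrableOn.locallyIntegrableOn hf) fun g hg hgs hgt => ?_
  have := h ⟨g, hg, hgs, hgt⟩
  rw [← setIntegral_eq_integral_of_forall_compl_eq_zero (s := Ioo 0 T)]
  · simp_rw [smul_eq_mul, mul_comm (g _)]
    exact this
  · intro x hx
    rw [image_eq_zero_of_notMem_tsupport fun h => hx (hgt h), zero_smul]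

/-! ### Approximation in L² by derivatives of test functions. -/

/-- Test functions are dense in `L²(0,T)`. -/
theorem exists_test_eLpNorm_sub_lt {φ : ℝ → ℝ} (hφ : MemLp φ 2 (leb T)) {ε : ℝ≥0∞}
    (hε : 0 < ε) : ∃ v : 𝓓(interval T, ℝ), eLpNorm (fun x => φ x - v x) 2 (leb T) < ε := by
  let ι : 𝓓(interval T, ℝ) →ₗ[ℝ] Lp ℝ 2 (leb T) :=
    { toFun := fun v => (test_memLp v).toLp v
      map_add' := fun v w => rfl
      map_smul' := fun c v => rfl }
  -- A subspace of a Hilbert space is dense once its orthogonal complement is trivial.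
  have hdense : (LinearMap.range ι).topologicalClosure = ⊤ := by
    rw [Submodule.topologicalClosure_eq_top_iff, Submodule.eq_bot_iff]
    intro f hf
    rw [Submodule.mem_orthogonal] at hf
    refine Lp.eq_zero_iff_ae_eq_zero.2 (ae_eq_zero_of_integral_mul_test
      (integrable_leb_of_memLp (Lp.memLp f)) fun v => ?_)
    have := hf (ι v) (LinearMap.mem_range_self ι v)
    rw [L2.inner_def] at this
    rw [← this]
    refine integral_congr_ae ?_
    filter_upwards [(test_memLp v).coeFn_toLp] with x hx
    have hx' : (ι v : ℝ → ℝ) x = v x := hx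
    simp [hx']
  have hmem : hφ.toLp φ ∈ closure ((LinearMap.range ι : Submodule ℝ _) : Set (Lp ℝ 2 (leb T))) := by
    rw [← Submodule.topologicalClosure_coe, hdense]
    trivial
  obtain ⟨_, ⟨v, rfl⟩, hv⟩ := EMetric.mem_closure_iff.1 hmem ε hε
  refine ⟨v, ?_⟩
  have h2 : edist (hφ.toLp φ) ((test_memLp v).toLp v) < ε := hv
  rw [Lp.edist_toLp_toLp] at h2
  exact h2

/-- The `L¹` distance is controlled by the `L²` distance. -/
theorem tendsto_integral_abs_of_tendsto_eLpNorm {f : ℕ → ℝ → ℝ} (hf : ∀ n, MemLp (f n) 2 (leb T))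
    (h : Tendsto (fun n => eLpNorm (f n) 2 (leb T)) atTop (𝓝 0)) :
    Tendsto (fun n => ∫ x, |f n x| ∂(leb T)) atTop (𝓝 0) := by
  have h1 : Tendsto (fun n => eLpNorm (f n) 1 (leb T)) atTop (𝓝 0) := by
    refine tendsto_of_tendsto_of_tendsto_of_le_of_le tendsto_const_nhds
      (h := fun n => eLpNorm (f n) 2 (leb T) *
        (leb T univ) ^ (1 / (1 : ℝ≥0∞).toReal - 1 / (2 : ℝ≥0∞).toReal)) ?_ (fun n => zero_le)
      (fun n => eLpNorm_le_eLpNorm_mul_rpow_measure_univ (by norm_num) (hf n).1)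
    have := ENNReal.Tendsto.mul_const
      (b := (leb T univ) ^ (1 / (1 : ℝ≥0∞).toReal - 1 / (2 : ℝ≥0∞).toReal)) h
      (Or.inr (ENNReal.rpow_ne_top_of_nonneg (by norm_num) (measure_ne_top _ _)))
    rwa [zero_mul] at this
  have h2 := (ENNReal.tendsto_toReal ENNReal.zero_ne_top).comp h1
  refine h2.congr fun n => ?_
  simp only [Function.comp_apply, eLpNorm_one_eq_lintegral_enorm]
  rw [← integral_norm_eq_lintegral_enorm (hf n).1]
  rfl

theorem tendsto_integral_of_tendsto_integral_abs_sub {f : ℕ → ℝ → ℝ} {g : ℝ → ℝ}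
    (hf : ∀ n, Integrable (f n) (leb T)) (hg : Integrable g (leb T))
    (h : Tendsto (fun n => ∫ x, |g x - f n x| ∂(leb T)) atTop (𝓝 0)) :
    Tendsto (fun n => ∫ x, f n x ∂(leb T)) atTop (𝓝 (∫ x, g x ∂(leb T))) := by
  rw [tendsto_iff_norm_sub_tendsto_zero]
  refine squeeze_zero (fun n => norm_nonneg _) (fun n => ?_) h
  rw [norm_sub_rev, ← integral_sub hg (hf n)]
  exact norm_integral_le_integral_norm _

/-- Pairing with an essentially bounded function is continuous for `L¹` convergence. -/
theorem tendsto_integral_mul_of_ae_bound {u : ℝ → ℝ} {C : ℝ}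
    (hum : AEStronglyMeasurable u (leb T)) (hu : ∀ᵐ x ∂(leb T), |u x| ≤ C)
    {f : ℕ → ℝ → ℝ} {g : ℝ → ℝ}
    (hf : ∀ n, Integrable (f n) (leb T)) (hg : Integrable g (leb T))
    (h : Tendsto (fun n => ∫ x, |g x - f n x| ∂(leb T)) atTop (𝓝 0)) :
    Tendsto (fun n => ∫ x, u x * f n x ∂(leb T)) atTop (𝓝 (∫ x, u x * g x ∂(leb T))) := by
  refine tendsto_integral_of_tendsto_integral_abs_sub (fun n => (hf n).bdd_mul hum hu)
    (hg.bdd_mul hum hu) ?_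
  refine squeeze_zero (fun n => integral_nonneg fun x => abs_nonneg _) (fun n => ?_)
    (by simpa using h.const_mul C)
  rw [← integral_const_mul]
  refine integral_mono_ae ((hg.bdd_mul hum hu).sub ((hf n).bdd_mul hum hu)).abs
    ((hg.sub (hf n)).abs.const_mul C) ?_
  filter_upwards [hu] with x hx
  show |u x * g x - u x * f n x| ≤ C * |g x - f n x|
  rw [← mul_sub, abs_mul]
  gcongr

/-- Since v(0) = 0, the difference is the integral of g - v' over (0,x). Thus L¹ convergence of
derivatives yields uniform convergence of primitives. -/
theorem test_sub_primitive_le (hT : 0 < T) {g : ℝ → ℝ} (hg : Integrable g (leb T))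
    (v : 𝓓(interval T, ℝ)) {x : ℝ} (hx : x ∈ Icc 0 T) :
    |(∫ t in (0 : ℝ)..x, g t) - v x| ≤ ∫ t, |g t - deriv v t| ∂(leb T) := by
  have h0 : (0 : ℝ) ∈ Icc 0 T := ⟨le_rfl, hT.le⟩
  have hgi := intervalIntegrable_of_mem_Icc hT hg h0 hx
  have hvx : v x = ∫ t in (0 : ℝ)..x, deriv v t := by rw [test_integral_deriv, test_zero, sub_zero]
  have hdi : IntervalIntegrable (deriv v) volume 0 x :=
    (test_continuous_deriv v).intervalIntegrable _ _
  rw [hvx, ← intervalIntegral.integral_sub hgi hdi]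
  refine (intervalIntegral.abs_integral_le_integral_abs hx.1).trans ?_
  rw [intervalIntegral.integral_of_le hx.1, integral_Ioc_eq_integral_Ioo]
  exact setIntegral_mono_set (hg.sub (test_integrable (testDeriv v))).abs
    (Eventually.of_forall fun _ => abs_nonneg _)
    (Ioo_subset_Ioo_right hx.2).eventuallyLE

theorem tendsto_zero_of_lt_inv_nat {f : ℕ → ℝ≥0∞} (h : ∀ n : ℕ, f n < ((n : ℝ≥0∞) + 1)⁻¹) :
    Tendsto f atTop (𝓝 0) := by
  refine tendsto_of_tendsto_of_tendsto_of_le_of_le tendsto_const_nhds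
    ?_ (fun n => zero_le) (fun n => (h n).le)
  have := (tendsto_add_atTop_iff_nat 1).2 ENNReal.tendsto_inv_nat_nhds_zero
  simpa using this

theorem tendsto_eLpNorm_add_mul {f : ℕ → ℝ → ℝ} (hf : ∀ n, MemLp (f n) 2 (leb T))
    (h : Tendsto (fun n => eLpNorm (f n) 2 (leb T)) atTop (𝓝 0)) {c : ℕ → ℝ}
    (hc : Tendsto c atTop (𝓝 0)) {g : ℝ → ℝ} (hg : MemLp g 2 (leb T)) :
    Tendsto (fun n => eLpNorm (fun x => f n x + c n * g x) 2 (leb T)) atTop (𝓝 0) := by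
  refine tendsto_of_tendsto_of_tendsto_of_le_of_le tendsto_const_nhds
    (h := fun n => eLpNorm (f n) 2 (leb T) + ‖c n‖ₑ * eLpNorm g 2 (leb T)) ?_
    (fun n => zero_le) (fun n => ?_)
  · have h1 : Tendsto (fun n => ‖c n‖ₑ) atTop (𝓝 0) := by simpa using hc.enorm
    have := h.add (ENNReal.Tendsto.mul_const h1 (b := eLpNorm g 2 (leb T))
      (Or.inr hg.eLpNorm_ne_top))
    simpa using this
  · refine (eLpNorm_add_le (hf n).1 (hg.1.const_mul (c n)) (by norm_num)).trans ?_
    exact add_le_add le_rfl (eLpNorm_const_smul (c n) g 2 (leb T)).le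

/-- Subtracting the mass of w, carried by the unit bump η, leaves mean zero. This corrects an
approximating sequence so that it consists of derivatives; the correction is negligible when the
masses tend to 0. -/
theorem exists_test_deriv_eq_sub (hT : 0 < T) {η : 𝓓(interval T, ℝ)}
    (hη : ∫ x, η x ∂(leb T) = 1) (w : 𝓓(interval T, ℝ)) :
    ∃ v : 𝓓(interval T, ℝ), deriv v = fun x => w x - (∫ t, w t ∂(leb T)) * η x :=
  exists_test_deriv_eq hT (w - (∫ x, w x ∂(leb T)) • η) (by
    show ∫ x, (w x - (∫ t, w t ∂(leb T)) * η x) ∂(leb T) = 0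
    rw [integral_sub (test_integrable _) ((test_integrable _).const_mul _), integral_const_mul,
      hη, mul_one, sub_self])

/-- An `L²` function of vanishing integral is the `L²` limit of derivatives of test functions. -/
theorem exists_seq_test_deriv_tendsto (hT : 0 < T) {φ : ℝ → ℝ} (hφ : MemLp φ 2 (leb T))
    (h0 : ∫ x, φ x ∂(leb T) = 0) :
    ∃ v : ℕ → 𝓓(interval T, ℝ),
      Tendsto (fun n => eLpNorm (fun x => φ x - deriv (v n) x) 2 (leb T)) atTop (𝓝 0) := by
  obtain ⟨η, hη⟩ := exists_test_integral_eq_one hT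
  have key : ∀ n : ℕ, ∃ w : 𝓓(interval T, ℝ),
      eLpNorm (fun x => φ x - w x) 2 (leb T) < ((n : ℝ≥0∞) + 1)⁻¹ := fun n =>
    exists_test_eLpNorm_sub_lt hφ (by simp)
  choose w hw using key
  have hwt := tendsto_zero_of_lt_inv_nat hw
  have hL1 := tendsto_integral_abs_of_tendsto_eLpNorm (fun n => hφ.sub (test_memLp (w n))) hwt
  have hc : Tendsto (fun n => ∫ x, w n x ∂(leb T)) atTop (𝓝 0) := by
    have := tendsto_integral_of_tendsto_integral_abs_sub (fun n => test_integrable (w n))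
      (integrable_leb_of_memLp hφ) hL1
    rwa [h0] at this
  have hprim := fun n => exists_test_deriv_eq_sub hT hη (w n)
  choose v hv using hprim
  refine ⟨v, ?_⟩
  refine (tendsto_eLpNorm_add_mul (fun n => hφ.sub (test_memLp (w n))) hwt hc
    (test_memLp η)).congr fun n => ?_
  congr 1
  funext x
  rw [hv n]
  show φ x - w n x + _ * η x = φ x - (w n x - _ * η x)
  ring

/-- An `L²` function of vanishing integral, whose primitive has vanishing integral, is the `L²`
limit of second derivatives of test functions. -/
theorem exists_seq_test_deriv_deriv_tendsto (hT : 0 < T) {φ : ℝ → ℝ} (hφ : MemLp φ 2 (leb T))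
    (h0 : ∫ x, φ x ∂(leb T) = 0) (h1 : ∫ x, (∫ t in (0 : ℝ)..x, φ t) ∂(leb T) = 0) :
    ∃ v : ℕ → 𝓓(interval T, ℝ),
      Tendsto (fun n => eLpNorm (fun x => φ x - deriv (deriv (v n)) x) 2 (leb T)) atTop (𝓝 0) := by
  obtain ⟨η, hη⟩ := exists_test_integral_eq_one hT
  obtain ⟨w, hw⟩ := exists_seq_test_deriv_tendsto hT hφ h0
  have hφi := integrable_leb_of_memLp hφ
  have hL1 := tendsto_integral_abs_of_tendsto_eLpNorm
    (fun n => hφ.sub (test_memLp (testDeriv (w n)))) hw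
  have hqi := integrable_leb_of_continuousOn (continuousOn_primitive hT hφi)
  -- The w n converge uniformly to the primitive of φ, whose mean is zero by `h1`; integrating the
  -- uniform error over (0,T) costs the factor T.
  have hc : Tendsto (fun n => ∫ x, w n x ∂(leb T)) atTop (𝓝 0) := by
    have := tendsto_integral_of_tendsto_integral_abs_sub (fun n => test_integrable (w n)) hqi
      (squeeze_zero (fun n => integral_nonneg fun x => abs_nonneg _) (fun n => ?_)
        (by simpa using hL1.mul_const T))
    · rwa [h1] at this
    · refine (integral_mono_ae (g := fun _ => ∫ t, |φ t - deriv (w n) t| ∂(leb T))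
        (hqi.sub (test_integrable (w n))).abs (integrable_const _) ?_).trans ?_
      · filter_upwards [ae_restrict_mem measurableSet_Ioo] with x hx
        exact test_sub_primitive_le hT hφi (w n) (Ioo_subset_Icc_self hx)
      · simp [hT.le, mul_comm]
  have hprim := fun n => exists_test_deriv_eq_sub hT hη (w n)
  choose v hv using hprim
  refine ⟨v, ?_⟩
  refine (tendsto_eLpNorm_add_mul (fun n => hφ.sub (test_memLp (testDeriv (w n)))) hw hc
    (test_memLp (testDeriv η))).congr fun n => ?_
  congr 1
  funext x
  have : deriv (deriv (v n)) x = deriv (w n) x - (∫ x, w n x ∂(leb T)) * deriv η x := by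
    rw [hv n]
    exact ((test_hasDerivAt (w n) x).sub ((test_hasDerivAt η x).const_mul _)).deriv
  rw [this]
  show φ x - deriv (w n) x + _ * deriv η x = _
  ring

/-! ### Integration against signed measures. -/

section SignedMeasure

variable {X : Type*} [MeasurableSpace X]

theorem isFiniteMeasure_variation (μ : SignedMeasure X) : IsFiniteMeasure μ.variation := by
  rw [← SignedMeasure.totalVariation_eq_variation]
  rw [SignedMeasure.totalVariation]
  infer_instance

theorem integrable_variation_of_bounded (μ : SignedMeasure X) {f : X → ℝ} (hf : Measurable f)
    {C : ℝ} (hC : ∀ x, |f x| ≤ C) : VectorMeasure.Integrable μ f :=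
  have := isFiniteMeasure_variation μ
  Integrable.of_bound hf.aestronglyMeasurable C (Eventually.of_forall hC)

theorem integrable_of_bounded (m : Measure X) [IsFiniteMeasure m] {f : X → ℝ} (hf : Measurable f)
    {C : ℝ} (hC : ∀ x, |f x| ≤ C) : Integrable f m :=
  Integrable.of_bound hf.aestronglyMeasurable C (Eventually.of_forall hC)

theorem integral_toSignedMeasure_sub (m₁ m₂ : Measure X) [IsFiniteMeasure m₁] [IsFiniteMeasure m₂]
    {f : X → ℝ} (hf : Measurable f) {C : ℝ} (hC : ∀ x, |f x| ≤ C) :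
    ∫ᵛ x, f x ∂<•(m₁.toSignedMeasure - m₂.toSignedMeasure) = ∫ x, f x ∂m₁ - ∫ x, f x ∂m₂ := by
  rw [VectorMeasure.integral_sub_vectorMeasure (integrable_variation_of_bounded _ hf hC)
    (integrable_variation_of_bounded _ hf hC), VectorMeasure.integral_toSignedMeasure,
    VectorMeasure.integral_toSignedMeasure]

/-- The integral against a signed measure in terms of its Jordan decomposition. -/
theorem integral_eq_posPart_sub_negPart (μ : SignedMeasure X) {f : X → ℝ} (hf : Measurable f)
    {C : ℝ} (hC : ∀ x, |f x| ≤ C) :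
    ∫ᵛ x, f x ∂<•μ = ∫ x, f x ∂μ.toJordanDecomposition.posPart
      - ∫ x, f x ∂μ.toJordanDecomposition.negPart := by
  rw [← integral_toSignedMeasure_sub _ _ hf hC]
  congr 1
  exact μ.toSignedMeasure_toJordanDecomposition.symm

theorem abs_integral_le_of_bounded (μ : SignedMeasure X) {f : X → ℝ} {C : ℝ}
    (hC : ∀ x, |f x| ≤ C) : |∫ᵛ x, f x ∂<•μ| ≤ C * μ.variation.real univ := by
  have := isFiniteMeasure_variation μ
  refine (VectorMeasure.norm_integral_le_integral_norm (μ := μ) (f := f)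
    (B := (ContinuousLinearMap.lsmul ℝ ℝ (E := ℝ)).flip)).trans ?_
  have hB : ‖(ContinuousLinearMap.lsmul ℝ ℝ (E := ℝ)).flip‖ ≤ 1 := by
    rw [ContinuousLinearMap.opNorm_flip]
    exact ContinuousLinearMap.opNorm_lsmul_le (R := ℝ)
  refine (mul_le_of_le_one_left (integral_nonneg fun _ => norm_nonneg _) hB).trans ?_
  rcases isEmpty_or_nonempty X with h | ⟨⟨x⟩⟩
  · simp [Measure.eq_zero_of_isEmpty]
  have : ∫ x, ‖f x‖ ∂μ.variation ≤ ∫ x, C ∂μ.variation :=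
    integral_mono_of_nonneg (Eventually.of_forall fun _ => norm_nonneg _)
      (integrable_const C) (Eventually.of_forall hC)
  refine this.trans (le_of_eq ?_)
  simp [mul_comm]

/-- Uniform limits can be exchanged with integration against a signed measure. -/
theorem tendsto_integral_of_uniform (μ : SignedMeasure X) {f : ℕ → X → ℝ} {g : X → ℝ}
    (hf : ∀ n, Measurable (f n)) (hfb : ∀ n, ∃ C, ∀ x, |f n x| ≤ C) (hg : Measurable g)
    {C : ℝ} (hgb : ∀ x, |g x| ≤ C) {e : ℕ → ℝ} (he : Tendsto e atTop (𝓝 0))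
    (h : ∀ n x, |g x - f n x| ≤ e n) :
    Tendsto (fun n => ∫ᵛ x, f n x ∂<•μ) atTop (𝓝 (∫ᵛ x, g x ∂<•μ)) := by
  rw [tendsto_iff_norm_sub_tendsto_zero]
  refine squeeze_zero (fun n => norm_nonneg _) (fun n => ?_)
    (by simpa using he.mul_const (μ.variation.real univ))
  obtain ⟨Cn, hCn⟩ := hfb n
  rw [norm_sub_rev, ← VectorMeasure.integral_fun_sub (integrable_variation_of_bounded _ hg hgb)
    (integrable_variation_of_bounded _ (hf n) hCn)]
  exact abs_integral_le_of_bounded μ (h n)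

theorem integral_le_const_mul (m : Measure X) [IsFiniteMeasure m] {f : X → ℝ}
    (hf : Measurable f) {a : ℝ} (hfa : ∀ x, |f x| ≤ a) : ∫ x, f x ∂m ≤ a * m.real univ := by
  have := integral_mono (integrable_of_bounded m hf hfa) (integrable_const a)
    (fun x => (le_abs_self _).trans (hfa x))
  simpa [mul_comm] using this

variable [TopologicalSpace X] [BorelSpace X] [SecondCountableTopology X]

/-- The function a - f is nonnegative, so equality means f = a almost everywhere. That set is
closed, hence contains the support; conversely the support is conull by second countability. -/
theorem integral_eq_const_mul_iff_support_subset (m : Measure X) [IsFiniteMeasure m] {f : X → ℝ}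
    (hf : Continuous f) {a : ℝ} (hfa : ∀ x, |f x| ≤ a) :
    ∫ x, f x ∂m = a * m.real univ ↔ m.support ⊆ {x | f x = a} := by
  have hfi := integrable_of_bounded m hf.measurable hfa
  have h1 : ∫ x, (a - f x) ∂m = a * m.real univ - ∫ x, f x ∂m := by
    rw [integral_sub (integrable_const a) hfi]
    simp [mul_comm]
  have h2 : ∫ x, f x ∂m = a * m.real univ ↔ ∫ x, (a - f x) ∂m = 0 := by
    rw [h1, sub_eq_zero, eq_comm]
  rw [h2, integral_eq_zero_iff_of_nonneg (fun x => sub_nonneg.2 ((le_abs_self _).trans (hfa x)))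
    ((integrable_const a).sub hfi)]
  constructor
  · intro h
    refine Measure.support_subset_of_isClosed (isClosed_eq hf continuous_const) ?_
    filter_upwards [h] with x hx
    have : a - f x = 0 := hx
    show f x = a
    linarith
  · intro h
    filter_upwards [Measure.support_mem_ae (μ := m)] with x hx
    have : f x = a := h hx
    simp [this]

end SignedMeasure

/-! ### Duality between continuous functions and M(0,T). -/

theorem mNorm_eq (μ : M T) : mNorm μ = μ.toJordanDecomposition.posPart.real univ
    + μ.toJordanDecomposition.negPart.real univ := by
  rw [mNorm, SignedMeasure.totalVariation, measureReal_add_apply]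

theorem integral_le_mul_mNorm (μ : M T) {f : Ioo (0 : ℝ) T → ℝ} (hf : Continuous f) {a : ℝ}
    (hfa : ∀ x, |f x| ≤ a) : ∫ᵛ x, f x ∂<•μ ≤ a * mNorm μ := by
  rw [integral_eq_posPart_sub_negPart μ hf.measurable hfa, mNorm_eq]
  have h1 := integral_le_const_mul μ.toJordanDecomposition.posPart hf.measurable hfa
  have h2 := integral_le_const_mul μ.toJordanDecomposition.negPart (f := fun x => -f x)
    hf.measurable.neg (a := a) (by simpa using hfa)
  rw [integral_neg] at h2
  linarith

/-- The equality case of the duality between continuous functions and signed measures. -/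
theorem integral_eq_mul_mNorm_iff (μ : M T) {f : Ioo (0 : ℝ) T → ℝ} (hf : Continuous f) {a : ℝ}
    (hfa : ∀ x, |f x| ≤ a) :
    ∫ᵛ x, f x ∂<•μ = a * mNorm μ ↔
      suppPos μ ⊆ {x | f x = a} ∧ suppNeg μ ⊆ {x | f x = -a} := by
  have hfa' : ∀ x, |-f x| ≤ a := by simpa using hfa
  have e1 := integral_eq_const_mul_iff_support_subset μ.toJordanDecomposition.posPart hf hfa
  have e2 := integral_eq_const_mul_iff_support_subset μ.toJordanDecomposition.negPart
    (f := fun x => -f x) hf.neg hfa'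
  have h1 := integral_le_const_mul μ.toJordanDecomposition.posPart hf.measurable hfa
  have h2 := integral_le_const_mul μ.toJordanDecomposition.negPart (f := fun x => -f x)
    hf.measurable.neg hfa'
  have e3 : {x | f x = -a} = {x | -f x = a} := by
    ext x
    exact neg_eq_iff_eq_neg.symm
  rw [integral_eq_posPart_sub_negPart μ hf.measurable hfa, mNorm_eq, suppPos, suppNeg, e3, ← e1,
    ← e2]
  rw [integral_neg] at h2 ⊢
  -- The bounds `h1` and `h2` hold separately, so equality in their sum forces equality in each.
  constructor
  · intro h
    constructor <;> linarith
  · rintro ⟨h, h'⟩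
    linarith

/-- Integration against the measure `w dx`. -/
theorem integral_toM {w : ℝ → ℝ} (hw : Integrable w (leb T)) {f : ℝ → ℝ}
    (hf : Measurable fun x : Ioo (0 : ℝ) T => f x) {C : ℝ} (hC : ∀ x ∈ Ioo 0 T, |f x| ≤ C) :
    ∫ᵛ x, f (x : ℝ) ∂<•(toM T w) = ∫ x, f x * w x ∂(leb T) := by
  have hemb := MeasurableEmbedding.subtype_coe (measurableSet_Ioo (a := (0 : ℝ)) (b := T))
  have hmap : Measure.map ((↑) : Ioo (0 : ℝ) T → ℝ)
      ((volume : Measure ℝ).comap ((↑) : Ioo (0 : ℝ) T → ℝ)) = leb T :=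
    map_comap_subtype_coe measurableSet_Ioo volume
  have hwi : Integrable (fun x : Ioo (0 : ℝ) T => w x)
      ((volume : Measure ℝ).comap ((↑) : Ioo (0 : ℝ) T → ℝ)) := by
    rw [← hmap, hemb.integrable_map_iff] at hw
    exact hw
  have := isFiniteMeasure_withDensity_ofReal hwi.2
  have : IsFiniteMeasure (((volume : Measure ℝ).comap ((↑) : Ioo (0 : ℝ) T → ℝ)).withDensity
      fun x => ENNReal.ofReal (-w x)) := isFiniteMeasure_withDensity_ofReal hwi.neg.2
  have hb : ∀ x : Ioo (0 : ℝ) T, |f x| ≤ C := fun x => hC x x.2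
  rw [toM, withDensityᵥ_eq_withDensity_pos_part_sub_withDensity_neg_part hwi]
  rw [integral_toSignedMeasure_sub _ _ hf hb,
    integral_withDensity_eq_integral_toReal_smul₀ hwi.1.aemeasurable.ennreal_ofReal
      (Eventually.of_forall fun _ => ENNReal.ofReal_lt_top),
    integral_withDensity_eq_integral_toReal_smul₀
      (f := fun x : Ioo (0 : ℝ) T => ENNReal.ofReal (-w x))
      hwi.1.aemeasurable.neg.ennreal_ofReal
      (Eventually.of_forall fun _ => ENNReal.ofReal_lt_top), ← integral_sub]
  · rw [← hmap, hemb.integral_map]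
    refine integral_congr_ae (Eventually.of_forall fun x => ?_)
    simp only [smul_eq_mul, ENNReal.toReal_ofReal']
    rw [← sub_mul, mul_comm]
    congr 1
    exact max_zero_sub_max_neg_zero_eq_self (w x)
  · refine (hwi.pos_part.bdd_mul hf.aestronglyMeasurable (Eventually.of_forall hb)).congr
      (Eventually.of_forall fun x => ?_)
    simp [ENNReal.toReal_ofReal', mul_comm]
  · refine (hwi.neg_part.bdd_mul hf.aestronglyMeasurable (Eventually.of_forall hb)).congr
      (Eventually.of_forall fun x => ?_)
    simp [ENNReal.toReal_ofReal', mul_comm]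

/-! ### Distribution functions and boundedness of BV functions. -/

/-- A finite measure is the distributional derivative of its distribution function. -/
theorem integral_cdf_mul_deriv (m : Measure (Ioo (0 : ℝ) T)) [IsFiniteMeasure m]
    (v : 𝓓(interval T, ℝ)) :
    ∫ x, m.real {y | (y : ℝ) < x} * deriv v x ∂(leb T) = - ∫ y, v (y : ℝ) ∂m := by
  have hset : MeasurableSet {z : ℝ × Ioo (0 : ℝ) T | (z.2 : ℝ) < z.1} :=
    measurableSet_lt (measurable_subtype_coe.comp measurable_snd) measurable_fst
  obtain ⟨C, hC⟩ := (test_continuous_deriv v).bounded_above_of_compact_support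
    v.hasCompactSupport.deriv
  -- Fubini on the region y < x: integrating v' over x in (y,T) gives v(T) - v(y) = -v(y).
  have hint : Integrable (Function.uncurry fun (x : ℝ) (y : Ioo (0 : ℝ) T) =>
      {z : ℝ × Ioo (0 : ℝ) T | (z.2 : ℝ) < z.1}.indicator (fun z => deriv v z.1) (x, y))
      ((leb T).prod m) := by
    refine integrable_of_bounded (C := C) _
      (((test_continuous_deriv v).measurable.comp measurable_fst).indicator hset) fun z => ?_
    refine le_trans ?_ (hC z.1)
    exact norm_indicator_le_norm_self (fun z : ℝ × Ioo (0 : ℝ) T => deriv v z.1) z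
  have hswap := integral_integral_swap hint
  have hl : ∀ x : ℝ, ∫ y : Ioo (0 : ℝ) T,
      {z : ℝ × Ioo (0 : ℝ) T | (z.2 : ℝ) < z.1}.indicator (fun z => deriv v z.1) (x, y) ∂m
      = m.real {y | (y : ℝ) < x} * deriv v x := by
    intro x
    have hs : MeasurableSet {y : Ioo (0 : ℝ) T | (y : ℝ) < x} :=
      measurableSet_lt measurable_subtype_coe measurable_const
    have := integral_indicator_const (μ := m) (deriv v x) hs
    rw [smul_eq_mul] at this
    rw [← this]
    rfl
  have hr : ∀ y : Ioo (0 : ℝ) T, ∫ x,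
      {z : ℝ × Ioo (0 : ℝ) T | (z.2 : ℝ) < z.1}.indicator (fun z => deriv v z.1) (x, y) ∂(leb T)
      = - v y := by
    intro y
    have h1 : ∫ x, (Ioi (y : ℝ)).indicator (deriv v) x ∂(leb T) = - v y := by
      rw [integral_indicator measurableSet_Ioi, Measure.restrict_restrict measurableSet_Ioi]
      have : Ioi (y : ℝ) ∩ Ioo 0 T = Ioo (y : ℝ) T := by
        ext x
        exact ⟨fun h => ⟨h.1, h.2.2⟩, fun h => ⟨h.1, y.2.1.trans h.1, h.2⟩⟩
      rw [this, ← integral_Ioc_eq_integral_Ioo, ← intervalIntegral.integral_of_le y.2.2.le,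
        test_integral_deriv, test_right, zero_sub]
    exact h1
  simp_rw [hl, hr, integral_neg] at hswap
  exact hswap

/-- The distribution function of a signed measure, defined through its Jordan decomposition. -/
def signedCdf (μ : M T) (x : ℝ) : ℝ :=
  μ.toJordanDecomposition.posPart.real {y | (y : ℝ) < x}
    - μ.toJordanDecomposition.negPart.real {y | (y : ℝ) < x}

theorem monotone_cdf (m : Measure (Ioo (0 : ℝ) T)) [IsFiniteMeasure m] :
    Monotone fun x : ℝ => m.real {y | (y : ℝ) < x} := fun _ _ hab =>
  measureReal_mono fun _ hy => lt_of_lt_of_le hy hab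

theorem measurable_signedCdf (μ : M T) : Measurable (signedCdf μ) :=
  (monotone_cdf _).measurable.sub (monotone_cdf _).measurable

theorem abs_signedCdf_le (μ : M T) (x : ℝ) : |signedCdf μ x| ≤ mNorm μ := by
  rw [mNorm_eq, signedCdf]
  have h1 := measureReal_mono (μ := μ.toJordanDecomposition.posPart)
    (subset_univ {y : Ioo (0 : ℝ) T | (y : ℝ) < x})
  have h2 := measureReal_mono (μ := μ.toJordanDecomposition.negPart)
    (subset_univ {y : Ioo (0 : ℝ) T | (y : ℝ) < x})
  have h3 := measureReal_nonneg (μ := μ.toJordanDecomposition.posPart)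
    (s := {y : Ioo (0 : ℝ) T | (y : ℝ) < x})
  have h4 := measureReal_nonneg (μ := μ.toJordanDecomposition.negPart)
    (s := {y : Ioo (0 : ℝ) T | (y : ℝ) < x})
  rw [abs_le]
  constructor <;> linarith

theorem exists_test_bound (v : 𝓓(interval T, ℝ)) : ∃ C, ∀ x, |v x| ≤ C :=
  v.continuous.bounded_above_of_compact_support v.hasCompactSupport

theorem isMeasDeriv_signedCdf (μ : M T) : IsMeasDeriv T (signedCdf μ) μ := by
  intro v
  obtain ⟨C, hC⟩ := exists_test_bound v
  rw [integral_eq_posPart_sub_negPart μ (f := fun x => v x)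
    (v.continuous.measurable.comp measurable_subtype_coe) (fun x => hC x)]
  have hi : ∀ (m : Measure (Ioo (0 : ℝ) T)) [IsFiniteMeasure m],
      Integrable (fun x => m.real {y | (y : ℝ) < x} * deriv v x) (leb T) := fun m _ =>
    (test_integrable (testDeriv v)).bdd_mul (c := m.real univ)
      (monotone_cdf m).measurable.aestronglyMeasurable (Eventually.of_forall fun x => by
        rw [Real.norm_of_nonneg measureReal_nonneg]
        exact measureReal_mono (subset_univ _))
  simp only [signedCdf, sub_mul]
  rw [integral_sub (hi _) (hi _), integral_cdf_mul_deriv, integral_cdf_mul_deriv]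
  ring

/-- A function whose distributional derivative vanishes is constant. -/
theorem exists_ae_eq_const_of_integral_mul_deriv (hT : 0 < T) {f : ℝ → ℝ}
    (hf : Integrable f (leb T))
    (h : ∀ v : 𝓓(interval T, ℝ), ∫ x, f x * deriv v x ∂(leb T) = 0) :
    ∃ c : ℝ, ∀ᵐ x ∂(leb T), f x = c := by
  obtain ⟨η, hη⟩ := exists_test_integral_eq_one hT
  have hfw : ∀ w : 𝓓(interval T, ℝ), Integrable (fun x => f x * w x) (leb T) := fun w => by
    obtain ⟨C, hC⟩ := exists_test_bound w
    exact hf.mul_bdd w.continuous.aestronglyMeasurable (Eventually.of_forall hC)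
  -- For any w, the function w - (∫ w) η is a derivative, so f annihilates it: ∫ f w = (∫ w)(∫ f η).
  -- Hence f - ∫ f η is orthogonal to every w.
  refine ⟨∫ x, f x * η x ∂(leb T), ?_⟩
  have := ae_eq_zero_of_integral_mul_test (hf.sub (integrable_const (∫ x, f x * η x ∂(leb T))))
    fun w => by
      obtain ⟨v, hv⟩ := exists_test_deriv_eq_sub hT hη w
      have h0 := h v
      simp only [hv, mul_sub] at h0
      have e1 : ∀ x, f x * ((∫ t, w t ∂(leb T)) * η x) = (∫ t, w t ∂(leb T)) * (f x * η x) :=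
        fun x => by ring
      simp only [e1] at h0
      rw [integral_sub (hfw w) ((hfw η).const_mul _), integral_const_mul] at h0
      simp only [Pi.sub_apply, sub_mul]
      rw [integral_sub (hfw w) ((test_integrable w).const_mul _), integral_const_mul]
      linarith
  filter_upwards [this] with x hx
  exact sub_eq_zero.1 hx

/-- Functions of bounded variation on a bounded interval are essentially bounded. -/
theorem exists_ae_bound_of_isMeasDeriv (hT : 0 < T) {u : ℝ → ℝ} (hu : Integrable u (leb T))
    {μ : M T} (hμ : IsMeasDeriv T u μ) : ∃ C, ∀ᵐ x ∂(leb T), |u x| ≤ C := by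
  have hF : Integrable (signedCdf μ) (leb T) :=
    integrable_of_bounded _ (measurable_signedCdf μ) (abs_signedCdf_le μ)
  -- u and the bounded function `signedCdf μ` have the same distributional derivative, so they
  -- differ by a constant.
  obtain ⟨c, hc⟩ := exists_ae_eq_const_of_integral_mul_deriv hT (hu.sub hF) fun v => by
    have h1 := hμ v
    have h2 := isMeasDeriv_signedCdf μ v
    obtain ⟨C, hC⟩ := exists_test_bound (testDeriv v)
    have hi : ∀ {g : ℝ → ℝ}, Integrable g (leb T) →
        Integrable (fun x => g x * deriv v x) (leb T) := fun hg =>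
      hg.mul_bdd (test_continuous_deriv v).aestronglyMeasurable (Eventually.of_forall hC)
    simp only [Pi.sub_apply, sub_mul]
    rw [integral_sub (hi hu) (hi hF), h1, h2, sub_self]
  refine ⟨|c| + mNorm μ, ?_⟩
  filter_upwards [hc] with x hx
  have : u x = c + signedCdf μ x := by
    have : u x - signedCdf μ x = c := hx
    linarith
  rw [this]
  exact (abs_add_le _ _).trans (add_le_add le_rfl (abs_signedCdf_le μ x))

/-! ### The primitives p and P: integration by parts and boundary values. -/

theorem continuousOn_negPrimitive (hT : 0 < T) {g : ℝ → ℝ} (hg : Integrable g (leb T)) :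
    ContinuousOn (negPrimitive g) (Icc 0 T) :=
  (continuousOn_primitive hT hg).neg

theorem memLp_negPrimitive (hT : 0 < T) {g : ℝ → ℝ} (hg : Integrable g (leb T)) :
    MemLp (negPrimitive g) 2 (leb T) :=
  memLp_leb_of_continuousOn (continuousOn_negPrimitive hT hg)

theorem isWeakDeriv_negPrimitive (hT : 0 < T) {g : ℝ → ℝ} (hg : Integrable g (leb T)) :
    IsWeakDeriv T (negPrimitive g) (fun x => -g x) :=
  (isWeakDeriv_primitive hT hg).neg

theorem continuous_restrict_Ioo {f : ℝ → ℝ} (hf : ContinuousOn f (Icc 0 T)) :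
    Continuous fun x : Ioo (0 : ℝ) T => f x :=
  continuousOn_iff_continuous_domRestrict.1 (hf.mono Ioo_subset_Icc_self)

theorem exists_bound_Ioo {f : ℝ → ℝ} (hf : ContinuousOn f (Icc 0 T)) :
    ∃ C, ∀ x : Ioo (0 : ℝ) T, |f x| ≤ C := by
  obtain ⟨C, hC⟩ := isCompact_Icc.exists_bound_of_continuousOn hf
  exact ⟨C, fun x => hC x (Ioo_subset_Icc_self x.2)⟩

/-- Integration by parts of a function of bounded variation against the primitive of an `L²`
function of vanishing integral. -/
theorem integral_mul_eq_integral_negPrimitive (hT : 0 < T) {u : ℝ → ℝ}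
    (hu : Integrable u (leb T)) {μ : M T} (hμ : IsMeasDeriv T u μ) {φ : ℝ → ℝ}
    (hφ : MemLp φ 2 (leb T)) (h0 : ∫ x, φ x ∂(leb T) = 0) :
    ∫ x, φ x * u x ∂(leb T) = ∫ᵛ x, negPrimitive φ (x : ℝ) ∂<•μ := by
  obtain ⟨C, hC⟩ := exists_ae_bound_of_isMeasDeriv hT hu hμ
  obtain ⟨v, hv⟩ := exists_seq_test_deriv_tendsto hT hφ h0
  have hφi := integrable_leb_of_memLp hφ
  -- This one L¹ error controls both sides: the pairing with u, which is essentially bounded, and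
  -- the uniform distance of v n from the primitive of φ, for the pairing with μ.
  have hL1 := tendsto_integral_abs_of_tendsto_eLpNorm
    (fun n => hφ.sub (test_memLp (testDeriv (v n)))) hv
  have h1 := tendsto_integral_mul_of_ae_bound hu.1 hC
    (fun n => test_integrable (testDeriv (v n))) hφi hL1
  have hq := continuousOn_primitive hT hφi
  obtain ⟨B, hB⟩ := exists_bound_Ioo hq
  have h2 := tendsto_integral_of_uniform μ (f := fun n x => v n x)
    (g := fun x => ∫ t in (0 : ℝ)..x, φ t)
    (fun n => (v n).continuous.measurable.comp measurable_subtype_coe)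
    (fun n => (exists_test_bound (v n)).imp fun C hC x => hC x)
    (continuous_restrict_Ioo hq).measurable hB hL1
    (fun n x => test_sub_primitive_le hT hφi (v n) (Ioo_subset_Icc_self x.2))
  have h3 := tendsto_nhds_unique h1 (h2.neg.congr fun n => (hμ (v n)).symm)
  simp only [negPrimitive]
  rw [VectorMeasure.integral_fun_neg, ← h3]
  simp only [mul_comm]

/-- The primitive of an `L²` function is in `H¹₀` if and only if its final value vanishes. -/
theorem memH10_negPrimitive_iff (hT : 0 < T) {φ : ℝ → ℝ} (hφ : MemLp φ 2 (leb T)) :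
    MemH10 T (negPrimitive φ) ↔ ∫ x, φ x ∂(leb T) = 0 := by
  have hφi := integrable_leb_of_memLp hφ
  constructor
  · rintro ⟨g, -, hg, hweak, happrox⟩
    -- Uniqueness of the weak derivative gives g = -φ. As an L² limit of derivatives of test
    -- functions, g has mean zero.
    have hae := ae_eq_zero_of_integral_mul_test ((integrable_leb_of_memLp hg).add hφi) fun v => by
      have h1 := hweak v
      rw [isWeakDeriv_negPrimitive hT hφi v] at h1
      obtain ⟨C, hC⟩ := exists_test_bound v
      simp only [Pi.add_apply, add_mul]
      rw [integral_add ((integrable_leb_of_memLp hg).mul_bdd v.continuous.aestronglyMeasurable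
          (Eventually.of_forall hC))
        (hφi.mul_bdd v.continuous.aestronglyMeasurable (Eventually.of_forall hC))]
      simp only [neg_mul, integral_neg] at h1
      linarith
    have key : ∀ n : ℕ, ∃ w : 𝓓(interval T, ℝ),
        eLpNorm (fun x => g x - deriv w x) 2 (leb T) < ((n : ℝ≥0∞) + 1)⁻¹ := fun n => by
      obtain ⟨w, hw⟩ := happrox ((n : ℝ≥0∞) + 1)⁻¹ (by simp)
      exact ⟨w, lt_of_le_of_lt le_add_self hw⟩
    choose w hw using key
    have hwt := tendsto_zero_of_lt_inv_nat hw
    have hL1 := tendsto_integral_abs_of_tendsto_eLpNorm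
      (fun n => hg.sub (test_memLp (testDeriv (w n)))) hwt
    have := tendsto_integral_of_tendsto_integral_abs_sub
      (fun n => test_integrable (testDeriv (w n))) (integrable_leb_of_memLp hg) hL1
    simp only [coe_testDeriv, test_integral_deriv_leb hT] at this
    have hg0 := tendsto_nhds_unique this tendsto_const_nhds
    have : ∫ x, φ x ∂(leb T) = ∫ x, -g x ∂(leb T) := by
      refine integral_congr_ae ?_
      filter_upwards [hae] with x hx
      have : g x + φ x = 0 := hx
      linarith
    rw [this, integral_neg, hg0, neg_zero]
  · intro h0
    refine ⟨fun x => -φ x, memLp_negPrimitive hT hφi, hφ.neg, isWeakDeriv_negPrimitive hT hφi,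
      fun ε hε => ?_⟩
    obtain ⟨v, hv⟩ := exists_seq_test_deriv_tendsto hT hφ h0
    have hL1 := tendsto_integral_abs_of_tendsto_eLpNorm
      (fun n => hφ.sub (test_memLp (testDeriv (v n)))) hv
    have h1 : Tendsto (fun n => eLpNorm (fun x => negPrimitive φ x - (-v n) x) 2 (leb T)) atTop
        (𝓝 0) := by
      refine tendsto_of_tendsto_of_tendsto_of_le_of_le tendsto_const_nhds
        (h := fun n => leb T univ ^ ((2 : ℝ≥0∞).toReal)⁻¹ *
          ENNReal.ofReal (∫ t, |φ t - deriv (v n) t| ∂(leb T))) ?_ (fun n => zero_le) fun n => ?_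
      · have := ENNReal.Tendsto.const_mul (a := leb T univ ^ ((2 : ℝ≥0∞).toReal)⁻¹)
          (ENNReal.tendsto_ofReal hL1)
          (Or.inr (ENNReal.rpow_ne_top_of_nonneg (by norm_num) (measure_ne_top _ _)))
        simpa using this
      · refine eLpNorm_le_of_ae_bound ?_
        filter_upwards [ae_restrict_mem measurableSet_Ioo] with x hx
        have := test_sub_primitive_le hT hφi (v n) (Ioo_subset_Icc_self hx)
        rw [show negPrimitive φ x - (-v n) x = -((∫ t in (0 : ℝ)..x, φ t) - v n x) by
          show -(∫ t in (0 : ℝ)..x, φ t) - -(v n x) = _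
          ring, norm_neg]
        exact this
    have h2 : Tendsto (fun n => eLpNorm (fun x => -φ x - deriv (-v n) x) 2 (leb T)) atTop
        (𝓝 0) := by
      refine hv.congr fun n => ?_
      rw [← eLpNorm_neg]
      congr 1
      funext x
      have : deriv (⇑(-v n)) x = -deriv (v n) x := ((test_hasDerivAt (v n) x).neg).deriv
      rw [this, Pi.neg_apply]
      ring
    have h3 := h1.add h2
    rw [add_zero] at h3
    obtain ⟨n, hn⟩ := (h3.eventually (gt_mem_nhds hε)).exists
    exact ⟨-v n, hn⟩

/-- The weak derivatives are -p and φ, with no boundary condition involved, so the H² clause of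
condition 1 is automatic. -/
theorem memH2_negPrimitive_negPrimitive (hT : 0 < T) {φ : ℝ → ℝ} (hφ : MemLp φ 2 (leb T)) :
    MemH2 T (negPrimitive (negPrimitive φ)) := by
  have hp := memLp_negPrimitive hT (integrable_leb_of_memLp hφ)
  refine ⟨fun x => -negPrimitive φ x, φ, memLp_negPrimitive hT (integrable_leb_of_memLp hp),
    hp.neg, hφ, isWeakDeriv_negPrimitive hT (integrable_leb_of_memLp hp), ?_⟩
  simpa using (isWeakDeriv_negPrimitive hT (integrable_leb_of_memLp hφ)).neg

/-- The pairing of `φ` with a function of bounded variation in terms of the primitives of `φ`. -/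
theorem integral_mul_eq_integral_add_integral (hT : 0 < T) {u w : ℝ → ℝ}
    (hu : MemBV T u) (hw : MemBV T w) {φ : ℝ → ℝ} (hφ : MemLp φ 2 (leb T))
    (h0 : ∫ x, φ x ∂(leb T) = 0) (h1 : ∫ x, negPrimitive φ x ∂(leb T) = 0) :
    ∫ x, φ x * u x ∂(leb T) = ∫ᵛ x, negPrimitive φ (x : ℝ) ∂<•(D T u - toM T w)
      + ∫ᵛ x, negPrimitive (negPrimitive φ) (x : ℝ) ∂<•(D T w) := by
  have hφi := integrable_leb_of_memLp hφ
  have hp := memLp_negPrimitive hT hφi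
  have hpc := continuousOn_negPrimitive hT hφi
  obtain ⟨C, hC⟩ := exists_bound_Ioo hpc
  have hm := (continuous_restrict_Ioo hpc).measurable
  rw [VectorMeasure.integral_sub_vectorMeasure (integrable_variation_of_bounded _ hm hC)
    (integrable_variation_of_bounded _ hm hC),
    integral_mul_eq_integral_negPrimitive hT hu.1 hu.isMeasDeriv_D hφ h0,
    ← integral_mul_eq_integral_negPrimitive hT hw.1 hw.isMeasDeriv_D hp h1,
    integral_toM hw.1 hm (fun x hx => hC ⟨x, hx⟩)]
  ring

/-! ### BV functions to test a subgradient with. -/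

theorem integrable_mul_test {u : ℝ → ℝ} (hu : Integrable u (leb T)) (v : 𝓓(interval T, ℝ)) :
    Integrable (fun x => u x * v x) (leb T) := by
  obtain ⟨C, hC⟩ := exists_test_bound v
  exact hu.mul_bdd v.continuous.aestronglyMeasurable (Eventually.of_forall hC)

theorem integrable_test_variation (v : 𝓓(interval T, ℝ)) (μ : M T) :
    VectorMeasure.Integrable μ fun x => v (x : ℝ) := by
  obtain ⟨C, hC⟩ := exists_test_bound v
  exact integrable_variation_of_bounded μ
    (v.continuous.measurable.comp measurable_subtype_coe) fun x => hC x

theorem MemBV.add {u w : ℝ → ℝ} (hu : MemBV T u) (hw : MemBV T w) :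
    MemBV T fun x => u x + w x := by
  obtain ⟨hui, μ, hμ⟩ := hu
  obtain ⟨hwi, ν, hν⟩ := hw
  refine ⟨hui.add hwi, μ + ν, fun v => ?_⟩
  simp only [add_mul]
  rw [integral_add (f := fun x => u x * deriv v x) (g := fun x => w x * deriv v x)
    (integrable_mul_test hui (testDeriv v)) (integrable_mul_test hwi (testDeriv v)),
    hμ v, hν v, VectorMeasure.integral_add_vectorMeasure (integrable_test_variation v μ)
    (integrable_test_variation v ν)]
  ring

theorem memBV_const (hT : 0 < T) (c : ℝ) : MemBV T fun _ => c := by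
  refine ⟨integrable_const c, 0, fun v => ?_⟩
  rw [integral_const_mul, test_integral_deriv_leb hT]
  simp

theorem isMeasDeriv_primitive (hT : 0 < T) {g : ℝ → ℝ} (hg : Integrable g (leb T)) :
    IsMeasDeriv T (fun x => ∫ t in (0 : ℝ)..x, g t) (toM T g) := by
  intro v
  obtain ⟨C, hC⟩ := exists_test_bound v
  rw [isWeakDeriv_primitive hT hg v, integral_toM hg
    (v.continuous.measurable.comp measurable_subtype_coe) fun x _ => hC x]
  simp only [mul_comm]

theorem integrable_primitive (hT : 0 < T) {g : ℝ → ℝ} (hg : Integrable g (leb T)) :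
    Integrable (fun x => ∫ t in (0 : ℝ)..x, g t) (leb T) :=
  integrable_leb_of_continuousOn (continuousOn_primitive hT hg)

theorem integral_indicator_Ioi_mul (c : ℝ) {a : ℝ} (ha : a ∈ Ioo 0 T) (f : ℝ → ℝ) :
    ∫ x, (Ioi a).indicator (fun _ => c) x * f x ∂(leb T) = c * ∫ x in a..T, f x := by
  have h1 : ∀ x, (Ioi a).indicator (fun _ => c) x * f x
      = (Ioi a).indicator (fun x => c * f x) x := fun x => by
    by_cases hx : x ∈ Ioi a <;> simp [hx]
  have h2 : Ioi a ∩ Ioo 0 T = Ioo a T := by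
    ext x
    exact ⟨fun h => ⟨h.1, h.2.2⟩, fun h => ⟨h.1, ha.1.trans h.1, h.2⟩⟩
  simp_rw [h1]
  rw [integral_indicator measurableSet_Ioi, Measure.restrict_restrict measurableSet_Ioi, h2,
    ← integral_Ioc_eq_integral_Ioo, ← intervalIntegral.integral_of_le ha.2.le,
    intervalIntegral.integral_const_mul]

theorem integrable_indicator_Ioi (c a : ℝ) :
    Integrable ((Ioi a).indicator fun _ => c) (leb T) :=
  (integrable_const c).indicator measurableSet_Ioi

theorem test_integral_deriv_Ioi (v : 𝓓(interval T, ℝ)) (c : ℝ) {a : ℝ} (ha : a ∈ Ioo 0 T) :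
    ∫ x, (Ioi a).indicator (fun _ => c) x * deriv v x ∂(leb T) = -(c * v a) := by
  rw [integral_indicator_Ioi_mul c ha, test_integral_deriv, test_right]
  ring

theorem memBV_indicator_Ioi (c : ℝ) {a : ℝ} (ha : a ∈ Ioo 0 T) :
    MemBV T ((Ioi a).indicator fun _ => c) := by
  refine ⟨integrable_indicator_Ioi c a, VectorMeasure.dirac (⟨a, ha⟩ : Ioo (0 : ℝ) T) c,
    fun v => ?_⟩
  rw [test_integral_deriv_Ioi v c ha, VectorMeasure.integral_dirac]
  rfl

theorem integrable_mul_of_memBV (hT : 0 < T) {u φ : ℝ → ℝ} (hu : MemBV T u)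
    (hφ : Integrable φ (leb T)) : Integrable (fun x => φ x * u x) (leb T) := by
  obtain ⟨C, hC⟩ := exists_ae_bound_of_isMeasDeriv hT hu.1 hu.isMeasDeriv_D
  exact hφ.mul_bdd hu.1.1 hC

/-! ### Necessity of condition 1. -/

theorem integral_mul_deriv_deriv_le_TGV (u : ℝ → ℝ) (v : 𝓓(interval T, ℝ))
    (h0 : ∀ x ∈ Ioo 0 T, |v x| ≤ β) (h1 : ∀ x ∈ Ioo 0 T, |deriv v x| ≤ α) :
    ((∫ x, u x * deriv (deriv v) x ∂(leb T) : ℝ) : EReal) ≤ TGV T α β u :=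
  le_iSup (fun v : {v : 𝓓(interval T, ℝ) //
      (∀ x ∈ Ioo 0 T, |v x| ≤ β) ∧ (∀ x ∈ Ioo 0 T, |deriv v x| ≤ α)} =>
    ((∫ x, u x * deriv (deriv v.1) x ∂(leb T) : ℝ) : EReal)) ⟨v, h0, h1⟩

/-- Subgradients are bounded by the total generalized variation. -/
theorem integral_mul_le_of_mem_subdiff {ubar φ : ℝ → ℝ} {R : ℝ}
    (hubar : MemBV T ubar) (hR : TGV T α β ubar = (R : EReal))
    (hφ : φ ∈ subdiff T α β ubar) {u : ℝ → ℝ} (hu : MemBV T u) {c : ℝ}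
    (hc : ∀ v : 𝓓(interval T, ℝ), (∀ x ∈ Ioo 0 T, |v x| ≤ β) →
      (∀ x ∈ Ioo 0 T, |deriv v x| ≤ α) → ∫ x, u x * deriv (deriv v) x ∂(leb T) ≤ c) :
    ∫ x, φ x * u x ∂(leb T) ≤ c := by
  -- Testing with ubar + u leaves ∫ φ u + R on the left; subadditivity bounds the right by R + c,
  -- and the finite R cancels.
  have h1 := hφ.2 _ (hubar.add hu)
  have h2 : TGV T α β (fun x => ubar x + u x) ≤ ((R + c : ℝ) : EReal) := by
    refine iSup_le fun v => EReal.coe_le_coe_iff.2 ?_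
    have h3 := integral_mul_deriv_deriv_le_TGV ubar v.1 v.2.1 v.2.2
    rw [hR, EReal.coe_le_coe_iff] at h3
    simp only [add_mul]
    rw [integral_add (f := fun x => ubar x * deriv (deriv v.1) x)
      (g := fun x => u x * deriv (deriv v.1) x) (integrable_mul_test hubar.1 (testDeriv (testDeriv v.1)))
      (integrable_mul_test hu.1 (testDeriv (testDeriv v.1)))]
    exact add_le_add h3 (hc v.1 v.2.1 v.2.2)
  have h4 := h1.trans h2
  rw [hR, ← EReal.coe_add, EReal.coe_le_coe_iff] at h4
  simp only [add_sub_cancel_left] at h4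
  linarith

/-- Homogeneity: the competitor 2 ubar gives one inequality and the competitor 0 the other. -/
theorem integral_mul_eq_of_mem_subdiff (hT : 0 < T) {ubar φ : ℝ → ℝ} {R : ℝ}
    (hubar : MemBV T ubar) (hR : TGV T α β ubar = (R : EReal))
    (hφ : φ ∈ subdiff T α β ubar) : ∫ x, φ x * ubar x ∂(leb T) = R := by
  apply le_antisymm
  · refine integral_mul_le_of_mem_subdiff hubar hR hφ hubar fun v h0 h1 => ?_
    have := integral_mul_deriv_deriv_le_TGV ubar v h0 h1
    rwa [hR, EReal.coe_le_coe_iff] at this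
  · have h1 := hφ.2 _ (memBV_const hT 0)
    have h2 : TGV T α β (fun _ => 0) ≤ ((0 : ℝ) : EReal) :=
      iSup_le fun v => by simp
    have h4 := h1.trans h2
    rw [hR, ← EReal.coe_add, EReal.coe_le_coe_iff] at h4
    simp only [zero_sub, mul_neg, integral_neg] at h4
    linarith

/-- The necessary conditions on the primitives of a subgradient. -/
theorem conditions_of_mem_subdiff (hT : 0 < T) {ubar φ : ℝ → ℝ} {R : ℝ}
    (hubar : MemBV T ubar) (hR : TGV T α β ubar = (R : EReal))
    (hφ : φ ∈ subdiff T α β ubar) :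
    ∫ x, φ x ∂(leb T) = 0 ∧ ∫ x, negPrimitive φ x ∂(leb T) = 0 ∧
      (∀ x ∈ Ioo 0 T, |negPrimitive φ x| ≤ α) ∧
      (∀ x ∈ Ioo 0 T, |negPrimitive (negPrimitive φ) x| ≤ β) := by
  have hφi := integrable_leb_of_memLp hφ.1
  have hpi := integrable_leb_of_memLp (memLp_negPrimitive hT hφi)
  have hle := fun {u : ℝ → ℝ} => integral_mul_le_of_mem_subdiff (u := u) hubar hR hφ
  have h0 : ∫ x, φ x ∂(leb T) = 0 := by
    have h : ∀ c : ℝ, ∫ x, φ x * c ∂(leb T) ≤ 0 := fun c =>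
      hle (memBV_const hT c) fun v _ _ => by
        rw [integral_const_mul, ← coe_testDeriv, test_integral_deriv_leb hT, mul_zero]
    have h1 := h 1
    have h2 := h (-1)
    rw [integral_mul_const] at h1 h2
    linarith
  -- Test with the primitive G of g: ∫ φ G = ∫ p g, while ∫ G v'' = -∫ g v'. One derivative fewer
  -- falls on v, so the bound on |v| can be used.
  have hprim : ∀ {g : ℝ → ℝ}, Integrable g (leb T) → ∀ {c : ℝ},
      (∀ v : 𝓓(interval T, ℝ), (∀ x ∈ Ioo 0 T, |v x| ≤ β) →
        -∫ x, g x * deriv v x ∂(leb T) ≤ c) →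
      ∫ x, g x * negPrimitive φ x ∂(leb T) ≤ c := by
    intro g hg c hc
    have hm := isMeasDeriv_primitive hT hg
    obtain ⟨C, hC⟩ := exists_bound_Ioo (continuousOn_negPrimitive hT hφi)
    have := hle ⟨integrable_primitive hT hg, _, hm⟩ (c := c) fun v hv0 _ => by
      rw [← coe_testDeriv v, isWeakDeriv_primitive hT hg (testDeriv v)]
      exact hc v hv0
    rw [integral_mul_eq_integral_negPrimitive hT (integrable_primitive hT hg) hm hφ.1 h0,
      integral_toM hg (continuous_restrict_Ioo (continuousOn_negPrimitive hT hφi)).measurable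
        (fun x hx => hC ⟨x, hx⟩)] at this
    simpa only [mul_comm] using this
  have h1 : ∫ x, negPrimitive φ x ∂(leb T) = 0 := by
    have h : ∀ c : ℝ, ∫ x, c * negPrimitive φ x ∂(leb T) ≤ 0 := fun c =>
      hprim (integrable_const c) fun v _ => by
        rw [integral_const_mul, test_integral_deriv_leb hT]
        simp
    have h1 := h 1
    have h2 := h (-1)
    rw [integral_const_mul] at h1 h2
    linarith
  have htail : ∀ {f : ℝ → ℝ}, Integrable f (leb T) → ∫ x, f x ∂(leb T) = 0 →
      ∀ a ∈ Ioo 0 T, ∫ x in a..T, f x = negPrimitive f a := by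
    intro f hf hf0 a ha
    rw [integral_leb hT, ← intervalIntegral.integral_add_adjacent_intervals
      (intervalIntegrable_of_mem_Icc hT hf (left_mem_Icc.2 hT.le) (Ioo_subset_Icc_self ha))
      (intervalIntegrable_of_mem_Icc hT hf (Ioo_subset_Icc_self ha) (right_mem_Icc.2 hT.le))]
      at hf0
    rw [negPrimitive]
    linarith
  refine ⟨h0, h1, fun a ha => ?_, fun a ha => ?_⟩
  -- A jump of height c = ±1 at a: ∫ u v'' = -c v'(a) ≤ α, whereas ∫ φ u = c p(a).
  · have h : ∀ c : ℝ, |c| = 1 → c * negPrimitive φ a ≤ α := fun c hc => by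
      have := hle (memBV_indicator_Ioi c ha) (c := α) fun v _ hv => by
        rw [← coe_testDeriv v, test_integral_deriv_Ioi (testDeriv v) c ha]
        refine (neg_le_abs _).trans ?_
        rw [abs_mul, hc, one_mul]
        exact hv a ha
      simp only [mul_comm (φ _)] at this
      rwa [integral_indicator_Ioi_mul c ha, htail hφi h0 a ha] at this
    have := h 1 (by simp)
    have := h (-1) (by simp)
    rw [abs_le]
    constructor <;> linarith
  -- A kink at a, the primitive of that jump: ∫ u v'' = c v(a) ≤ β, whereas ∫ φ u = c P(a).
  · have h : ∀ c : ℝ, |c| = 1 → c * negPrimitive (negPrimitive φ) a ≤ β := fun c hc => by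
      have := hprim (integrable_indicator_Ioi c a) (c := β) fun v hv => by
        rw [test_integral_deriv_Ioi v c ha, neg_neg]
        refine (le_abs_self _).trans ?_
        rw [abs_mul, hc, one_mul]
        exact hv a ha
      rwa [integral_indicator_Ioi_mul c ha, htail hpi h1 a ha] at this
    have := h 1 (by simp)
    have := h (-1) (by simp)
    rw [abs_le]
    constructor <;> linarith

/-! ### Sufficiency of condition 1. -/

/-- A function whose primitives vanish at the boundary and satisfy the constraints of the dual
problem is bounded by the total generalized variation. -/
theorem integral_mul_le_TGV (hT : 0 < T) (hα : 0 < α) (hβ : 0 < β) {φ u : ℝ → ℝ}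
    (hu : MemBV T u) (hφ : MemLp φ 2 (leb T))
    (h0 : ∫ x, φ x ∂(leb T) = 0) (h1 : ∫ x, negPrimitive φ x ∂(leb T) = 0)
    (hp : ∀ x ∈ Ioo 0 T, |negPrimitive φ x| ≤ α)
    (hP : ∀ x ∈ Ioo 0 T, |negPrimitive (negPrimitive φ) x| ≤ β) :
    ((∫ x, φ x * u x ∂(leb T) : ℝ) : EReal) ≤ TGV T α β u := by
  have hφi := integrable_leb_of_memLp hφ
  have hqi := integrable_primitive hT hφi
  obtain ⟨C, hC⟩ := exists_ae_bound_of_isMeasDeriv hT hu.1 hu.isMeasDeriv_D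
  obtain ⟨v, hv⟩ := exists_seq_test_deriv_deriv_tendsto hT hφ h0 (by
    simpa only [negPrimitive, integral_neg, neg_eq_zero] using h1)
  have hL1 := tendsto_integral_abs_of_tendsto_eLpNorm
    (fun n => hφ.sub (test_memLp (testDeriv (testDeriv (v n))))) hv
  set e : ℕ → ℝ := fun n => ∫ x, |φ x - deriv (deriv (v n)) x| ∂(leb T) with he
  have he0 : ∀ n, 0 ≤ e n := fun n => integral_nonneg fun x => abs_nonneg _
  have hd1 : ∀ n, ∀ x ∈ Icc 0 T, |(∫ t in (0 : ℝ)..x, φ t) - deriv (v n) x| ≤ e n :=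
    fun n x hx => test_sub_primitive_le hT hφi (testDeriv (v n)) hx
  have hd0 : ∀ n, ∀ x ∈ Icc 0 T,
      |negPrimitive (negPrimitive φ) x - v n x| ≤ T * e n := by
    intro n x hx
    have h2 : negPrimitive (negPrimitive φ) x = ∫ t in (0 : ℝ)..x, ∫ s in (0 : ℝ)..t, φ s := by
      simp only [negPrimitive, intervalIntegral.integral_neg, neg_neg]
    rw [h2]
    refine (test_sub_primitive_le hT hqi (v n) hx).trans ?_
    refine (integral_mono_ae (g := fun _ => e n)
      (hqi.sub (test_integrable (testDeriv (v n)))).abs (integrable_const _) ?_).trans ?_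
    · filter_upwards [ae_restrict_mem measurableSet_Ioo] with x hx
      exact hd1 n x (Ioo_subset_Icc_self hx)
    · simp [hT.le]
  -- The errors give |v'| ≤ α + e and |v| ≤ β + T e. The factor s dominates both relative excesses
  -- e/α and T e/β, so v/s is admissible, and s tends to 1.
  set s : ℕ → ℝ := fun n => 1 + e n / α + T * e n / β with hs
  have hs1 : ∀ n, 0 < s n := fun n => by
    have := he0 n
    positivity
  have hslim : Tendsto s atTop (𝓝 1) := by
    have := (hL1.div_const α).const_add 1 |>.add ((hL1.const_mul T).div_const β)
    simpa using this
  have hder : ∀ n, deriv (⇑((s n)⁻¹ • v n)) = fun x => (s n)⁻¹ * deriv (v n) x := fun n =>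
    funext fun x => ((test_hasDerivAt (v n) x).const_mul (s n)⁻¹).deriv
  have hder2 : ∀ n, deriv (deriv (⇑((s n)⁻¹ • v n)))
      = fun x => (s n)⁻¹ * deriv (deriv (v n)) x := fun n => by
    rw [hder n]
    exact funext fun x => ((test_hasDerivAt (testDeriv (v n)) x).const_mul (s n)⁻¹).deriv
  have hscale : ∀ n (y : ℝ) {b : ℝ}, |y| ≤ b * s n → |(s n)⁻¹ * y| ≤ b := fun n y b hy => by
    rw [abs_mul, abs_of_pos (inv_pos.2 (hs1 n)), inv_mul_le_iff₀ (hs1 n), mul_comm]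
    exact hy
  have hle : ∀ n, (((s n)⁻¹ * ∫ x, u x * deriv (deriv (v n)) x ∂(leb T) : ℝ) : EReal)
      ≤ TGV T α β u := by
    intro n
    have hv0 : ∀ x ∈ Ioo 0 T, |v n x| ≤ β * s n := by
      intro x hx
      have h2 := hd0 n x (Ioo_subset_Icc_self hx)
      have h3 := hP x hx
      have h4 : β * s n = β + T * e n + β / α * e n := by
        rw [hs]; field_simp; ring
      have h5 : 0 ≤ β / α * e n := mul_nonneg (by positivity) (he0 n)
      rw [abs_le] at h2 h3 ⊢
      constructor <;> linarith
    have hv1 : ∀ x ∈ Ioo 0 T, |deriv (v n) x| ≤ α * s n := by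
      intro x hx
      have h2 := hd1 n x (Ioo_subset_Icc_self hx)
      have h3 := hp x hx
      rw [negPrimitive, abs_neg] at h3
      have h4 : α * s n = α + e n + α * T / β * e n := by
        rw [hs]; field_simp
      have h5 : 0 ≤ α * T / β * e n := mul_nonneg (by positivity) (he0 n)
      rw [abs_le] at h2 h3 ⊢
      constructor <;> linarith
    have := integral_mul_deriv_deriv_le_TGV (α := α) (β := β) u ((s n)⁻¹ • v n)
      (fun x hx => hscale n (v n x) (hv0 x hx))
      (fun x hx => by rw [hder n]; exact hscale n (deriv (v n) x) (hv1 x hx))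
    rw [hder2 n] at this
    simp only [mul_left_comm (u _)] at this
    rwa [integral_const_mul] at this
  have hlim := tendsto_integral_mul_of_ae_bound hu.1.1 hC
    (fun n => test_integrable (testDeriv (testDeriv (v n)))) hφi hL1
  have hlim2 := (hslim.inv₀ one_ne_zero).mul hlim
  rw [inv_one, one_mul] at hlim2
  simp only [mul_comm (φ _)]
  exact le_of_tendsto' ((continuous_coe_real_ereal.tendsto _).comp hlim2) hle

end TGV1D

end

/-! ### The characterization of the subdifferential. -/

open TGV1D in
theorem theorem4p2 (T α β : ℝ) (hT : 0 < T) (hα : 0 < α) (hβ : 0 < β)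
    (ubar wbar : ℝ → ℝ) (hu : TGV1D.MemBV T ubar) (hw : TGV1D.MemBV T wbar)
    (hopt : TGV1D.TGV T α β ubar =
      ((α * TGV1D.mNorm (TGV1D.D T ubar - TGV1D.toM T wbar)
        + β * TGV1D.mNorm (TGV1D.D T wbar) : ℝ) : EReal))
    (φ p P : ℝ → ℝ) (hφ : MemLp φ 2 (TGV1D.leb T))
    (hp : p = TGV1D.negPrimitive φ) (hP : P = TGV1D.negPrimitive p) :
    φ ∈ TGV1D.subdiff T α β ubar ↔
      (TGV1D.MemH10 T p ∧ (TGV1D.MemH2 T P ∧ TGV1D.MemH10 T P) ∧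
        (∀ x ∈ Ioo 0 T, |p x| ≤ α) ∧ (∀ x ∈ Ioo 0 T, |P x| ≤ β)) ∧
      (TGV1D.suppPos (TGV1D.D T ubar - TGV1D.toM T wbar) ⊆ {x | p x = α} ∧
        TGV1D.suppNeg (TGV1D.D T ubar - TGV1D.toM T wbar) ⊆ {x | p x = -α} ∧
        TGV1D.suppPos (TGV1D.D T wbar) ⊆ {x | P x = β} ∧
        TGV1D.suppNeg (TGV1D.D T wbar) ⊆ {x | P x = -β}) := by
  subst hp hP
  have hφi := integrable_leb_of_memLp hφ
  have hpL := memLp_negPrimitive hT hφi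
  have hpc := continuous_restrict_Ioo (continuousOn_negPrimitive hT hφi)
  have hPc := continuous_restrict_Ioo (continuousOn_negPrimitive hT (integrable_leb_of_memLp hpL))
  rw [memH10_negPrimitive_iff hT hφ, memH10_negPrimitive_iff hT hpL]
  constructor
  · intro h
    obtain ⟨h0, h1, hpα, hPβ⟩ := conditions_of_mem_subdiff hT hu hopt h
    have h2 := integral_mul_eq_of_mem_subdiff hT hu hopt h
    rw [integral_mul_eq_integral_add_integral hT hu hw hφ h0 h1] at h2
    have h3 := integral_le_mul_mNorm (D T ubar - toM T wbar) hpc fun x => hpα x x.2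
    have h4 := integral_le_mul_mNorm (D T wbar) hPc fun x => hPβ x x.2
    -- The two pairings sum to TGV(ubar), which is also the sum of their upper bounds, so both
    -- bounds are attained.
    obtain ⟨h5, h6⟩ := (integral_eq_mul_mNorm_iff (D T ubar - toM T wbar) hpc
      fun x => hpα x x.2).1 (by linarith)
    obtain ⟨h7, h8⟩ := (integral_eq_mul_mNorm_iff (D T wbar) hPc
      fun x => hPβ x x.2).1 (by linarith)
    exact ⟨⟨h0, ⟨memH2_negPrimitive_negPrimitive hT hφ, h1⟩, hpα, hPβ⟩, h5, h6, h7, h8⟩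
  · rintro ⟨⟨h0, ⟨-, h1⟩, hpα, hPβ⟩, h5, h6, h7, h8⟩
    refine ⟨hφ, fun u hu' => ?_⟩
    have h3 := (integral_eq_mul_mNorm_iff (D T ubar - toM T wbar) hpc
      fun x => hpα x x.2).2 ⟨h5, h6⟩
    have h4 := (integral_eq_mul_mNorm_iff (D T wbar) hPc fun x => hPβ x x.2).2 ⟨h7, h8⟩
    have h2 := integral_mul_eq_integral_add_integral hT hu hw hφ h0 h1
    rw [h3, h4] at h2
    simp only [mul_sub]
    rw [integral_sub (integrable_mul_of_memBV hT hu' hφi) (integrable_mul_of_memBV hT hu hφi),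
      hopt, ← EReal.coe_add, h2, sub_add_cancel]
    exact integral_mul_le_TGV hT hα hβ hu' hφ h0 h1 hpα hPβ
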